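/- For a finite simple connected graph $G$ on $n$ vertices, call a nonempty set $S\subseteq V(G)$ a connected set if the induced subgraph $G[S]$ is connected. Let $N(G)$ be the number of connected sets of $G$, let $A(G)=N(G)^{-1}\sum_{S}|S|$ (sum over all connected sets $S$) be their average order, and let $D(G)=A(G)/n$ be the connected set density of $G$. For $c\in(1/2,1)$ let $\alpha(c)$ denote the unique $\alpha\in(1/2,1)$ with $\alpha^{-\alpha}(1-\alpha)^{\alpha-1}=2c$. Theorem. Every finite simple connected graph $G$ with at least two vertices and no vertex of degree $2$ satisfies $$D(G)<\alpha(2^{-3/4})<0.95831 .$$ In particular, finite connected graphs with minimum degree at least $3$ cannot have connected set density arbitrarily close to $1$: there is $\varepsilon>0$ such that $D(G)\le 1-\varepsilon$ for every finite simple connected graph $G$ with minimum degree at least $3$. -/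

import Mathlib

/-- The family of connected sets of a finite graph: the nonempty vertex sets `S` such that the
induced subgraph on `S` is connected. -/
noncomputable def SimpleGraph.connectedSets {V : Type*} [Fintype V] (G : SimpleGraph V) :
    Finset (Finset V) :=
  open Classical in
  Finset.univ.filter fun S => S.Nonempty ∧ (G.induce (S : Set V)).Connected

/-- The number `N(G)` of connected sets of `G`. -/
noncomputable def SimpleGraph.numConnectedSets {V : Type*} [Fintype V] (G : SimpleGraph V) : ℕ :=
  G.connectedSets.card

/-- The average order `A(G)` of the connected sets of `G`. -/
noncomputable def SimpleGraph.avgConnectedSetOrder {V : Type*} [Fintype V]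
    (G : SimpleGraph V) : ℝ :=
  (G.numConnectedSets : ℝ)⁻¹ * ∑ S ∈ G.connectedSets, (S.card : ℝ)

/-- The connected set density `D(G) = A(G) / |V(G)|`. -/
noncomputable def SimpleGraph.connectedSetDensity {V : Type*} [Fintype V]
    (G : SimpleGraph V) : ℝ :=
  G.avgConnectedSetOrder / (Fintype.card V : ℝ)

/-- `a` lies in `(1/2, 1)` and satisfies `a ^ (-a) * (1 - a) ^ (a - 1) = 2 * c`. -/
def IsEntropyRoot (c a : ℝ) : Prop :=
  (1 / 2 < a ∧ a < 1) ∧ a ^ (-a) * (1 - a) ^ (a - 1) = 2 * c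

/-- For every `c ∈ (1/2, 1)` the defining equation has exactly one solution in `(1/2, 1)`. -/
theorem existsUnique_isEntropyRoot {c : ℝ} (h1 : 1 / 2 < c) (h2 : c < 1) :
    ∃! a : ℝ, IsEntropyRoot c a := by
  have key : ∀ a : ℝ, 1 / 2 < a → a < 1 →
      a ^ (-a) * (1 - a) ^ (a - 1) = Real.exp (Real.binEntropy a) := by
    intro a ha hb
    rw [Real.rpow_def_of_pos (by linarith), Real.rpow_def_of_pos (by linarith), ← Real.exp_add,
      Real.binEntropy, Real.log_inv, Real.log_inv]
    congr 1
    ring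
  have hanti := Real.binEntropy_strictAntiOn
  have hl1 : 0 < Real.log (2 * c) := Real.log_pos (by linarith)
  have hl2 : Real.log (2 * c) < Real.log 2 := Real.log_lt_log (by linarith) (by linarith)
  have hex : ∃ a ∈ Set.Ioo (1 / 2 : ℝ) 1, Real.binEntropy a = Real.log (2 * c) := by
    have h := intermediate_value_Ioo' (a := (1 / 2 : ℝ)) (b := 1) (by norm_num)
      (Real.binEntropy_continuous.continuousOn)
    apply h
    constructor
    · simpa using hl1
    · have : Real.binEntropy (1 / 2) = Real.log 2 := by
        rw [one_div]
        exact Real.binEntropy_two_inv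
      rw [this]
      exact hl2
  obtain ⟨a, ⟨ha, hb⟩, hab⟩ := hex
  refine ⟨a, ⟨⟨ha, hb⟩, ?_⟩, ?_⟩
  · rw [key a ha hb, hab, Real.exp_log (by linarith)]
  · rintro b ⟨⟨hb1, hb2⟩, hbe⟩
    rw [key b hb1 hb2] at hbe
    have hbe' : Real.binEntropy b = Real.log (2 * c) := by rw [← hbe, Real.log_exp]
    exact hanti.injOn ⟨by linarith, hb2.le⟩ ⟨by linarith, hb.le⟩ (hbe'.trans hab.symm)

/-- `entropyRoot c` is the root `α(c)` in `(1/2, 1)` of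
`α ^ (-α) * (1 - α) ^ (α - 1) = 2 * c`, which exists and is unique for `1/2 < c < 1`
(outside this range the value is irrelevant). -/
noncomputable def entropyRoot (c : ℝ) : ℝ :=
  Classical.epsilon (IsEntropyRoot c)

theorem entropyRoot_spec {c : ℝ} (h1 : 1 / 2 < c) (h2 : c < 1) :
    IsEntropyRoot c (entropyRoot c) :=
  Classical.epsilon_spec (existsUnique_isEntropyRoot h1 h2).exists

/-! Two bounds on the number of connected sets collide. If a family of subsets of an n-set has
average size at least pn with p ≥ 1/2, it has at most exp(n H(p)) members, H being binary entropy
(`card_le_exp_binEntropy`). On the other hand, a connected dominating set C with outer boundary B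
gives 2^|B| connected sets C ∪ X, X ⊆ B (`two_pow_lt_numConnectedSets`). Without vertices of degree
2, C can be chosen with |B| ≥ n/4 (`exists_connected_dominating`), so there are more than 2^(n/4)
connected sets. The root α is exactly where H(α) = (log 2)/4, so density at least α is impossible.

The set C is grown greedily, keeping |C| ≤ 2|B| + |D|, where D ⊆ B is the set of dead boundary
vertices. Once C ∪ B is everything, n ≤ |C| + |B| ≤ 4|B|. -/

open Finset in
/-- If the members of a family of subsets have average density at least `p ≥ 1/2`, then the family
has at most `exp (n * binEntropy p)` members. -/
theorem card_le_exp_binEntropy {V : Type*} [Fintype V] {p : ℝ} (hp : 1 / 2 ≤ p) (hp1 : p < 1)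
    (F : Finset (Finset V))
    (hF : p * (Fintype.card V : ℝ) * (F.card : ℝ) ≤ ∑ S ∈ F, (S.card : ℝ)) :
    (F.card : ℝ) ≤ Real.exp ((Fintype.card V : ℝ) * Real.binEntropy p) := by
  set n := Fintype.card V with hn
  have hp0 : 0 < p := by linarith
  have hq0 : 0 < 1 - p := by linarith
  -- The log-odds: a p-random subset equals `S` with probability exp(m + l(|S| - pn)). Here p ≥ 1/2
  -- gives l ≥ 0.
  set l := Real.log p - Real.log (1 - p) with hl
  have hl0 : 0 ≤ l := sub_nonneg.2 (Real.log_le_log hq0 (by linarith))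
  set m := -((n : ℝ) * Real.binEntropy p) with hm
  have hm' : m = n * (p * Real.log p + (1 - p) * Real.log (1 - p)) := by
    rw [hm, Real.binEntropy, Real.log_inv, Real.log_inv]; ring
  have hterm : ∀ S : Finset V, Real.exp m * (1 + l * ((S.card : ℝ) - p * n)) ≤
      p ^ S.card * (1 - p) ^ (n - S.card) := by
    intro S
    have hS : S.card ≤ n := S.card_le_univ
    have heq : p ^ S.card * (1 - p) ^ (n - S.card) =
        Real.exp m * Real.exp (l * ((S.card : ℝ) - p * n)) := by
      have h1 : p ^ S.card = Real.exp (S.card * Real.log p) := by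
        rw [Real.exp_nat_mul, Real.exp_log hp0]
      have h2 : (1 - p) ^ (n - S.card) = Real.exp (((n - S.card : ℕ) : ℝ) * Real.log (1 - p)) := by
        rw [Real.exp_nat_mul, Real.exp_log hq0]
      rw [h1, h2, ← Real.exp_add, ← Real.exp_add, Nat.cast_sub hS, hm', hl]
      congr 1; ring
    rw [heq]
    -- The tangent line of exp makes the bound linear in |S|, so only the average size matters.
    have := Real.add_one_le_exp (l * ((S.card : ℝ) - p * n))
    gcongr
    linarith
  have hsum : ∑ S ∈ F, Real.exp m * (1 + l * ((S.card : ℝ) - p * n)) ≤ 1 := by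
    calc _ ≤ ∑ S ∈ F, p ^ S.card * (1 - p) ^ (n - S.card) := sum_le_sum fun S _ => hterm S
      _ ≤ ∑ S : Finset V, p ^ S.card * (1 - p) ^ (n - S.card) :=
        sum_le_sum_of_subset_of_nonneg (subset_univ _) fun _ _ _ => by positivity
      _ = 1 := by rw [Fintype.sum_pow_mul_eq_add_pow]; simp
  rw [← mul_sum, sum_add_distrib, ← mul_sum, sum_sub_distrib] at hsum
  simp only [sum_const, nsmul_eq_mul, mul_one] at hsum
  have h0 : 0 ≤ l * (∑ S ∈ F, (S.card : ℝ) - F.card * (p * n)) :=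
    mul_nonneg hl0 (by linarith)
  have h1 : Real.exp m * F.card ≤ 1 :=
    le_trans (mul_le_mul_of_nonneg_left (by linarith) (Real.exp_pos m).le) hsum
  rw [hm, Real.exp_neg, inv_mul_le_iff₀ (Real.exp_pos _), mul_one] at h1
  exact h1

/-! ### Connected dominating sets with large complement -/

namespace SimpleGraph

open Finset

theorem mem_connectedSets {V : Type*} [Fintype V] {G : SimpleGraph V} {S : Finset V} :
    S ∈ G.connectedSets ↔ S.Nonempty ∧ (G.induce (S : Set V)).Connected := by
  simp [connectedSets]

variable {V : Type*} [Fintype V] [DecidableEq V] (G : SimpleGraph V)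

open Classical in
/-- The vertices outside `C` that are adjacent to `C`. -/
noncomputable def outerBoundary (C : Finset V) : Finset V :=
  univ.filter fun v => v ∉ C ∧ ∃ c ∈ C, G.Adj c v

open Classical in
/-- The neighbours of `v` that neither lie in `C` nor are adjacent to `C`. -/
noncomputable def freshNeighbors (C : Finset V) (v : V) : Finset V :=
  univ.filter fun w => G.Adj v w ∧ w ∉ C ∧ ∀ c ∈ C, ¬ G.Adj c w

/-- The vertices of the outer boundary of `C` without fresh neighbours. -/
noncomputable def deadBoundary (C : Finset V) : Finset V :=
  (G.outerBoundary C).filter fun v => G.freshNeighbors C v = ∅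

variable {G} {C : Finset V} {b v w : V}

theorem mem_outerBoundary : v ∈ G.outerBoundary C ↔ v ∉ C ∧ ∃ c ∈ C, G.Adj c v := by
  simp [outerBoundary]

theorem mem_freshNeighbors :
    w ∈ G.freshNeighbors C v ↔ G.Adj v w ∧ w ∉ C ∧ ∀ c ∈ C, ¬ G.Adj c w := by
  simp [freshNeighbors]

theorem mem_deadBoundary :
    v ∈ G.deadBoundary C ↔ v ∈ G.outerBoundary C ∧ G.freshNeighbors C v = ∅ := by
  simp [deadBoundary]

theorem freshNeighbors_insert_subset : G.freshNeighbors (insert b C) v ⊆ G.freshNeighbors C v := by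
  intro w
  simp only [mem_freshNeighbors, mem_insert]
  grind

/-- Absorbing `b` removes only `b` from the boundary and adds its fresh neighbours; the `+ 1` avoids
truncated subtraction. -/
theorem card_outerBoundary_insert (hb : b ∈ G.outerBoundary C) :
    (G.outerBoundary C).card + (G.freshNeighbors C b).card ≤
      (G.outerBoundary (insert b C)).card + 1 := by
  have hsub : (G.outerBoundary C).erase b ∪ G.freshNeighbors C b ⊆
      G.outerBoundary (insert b C) := by
    intro w
    have := G.loopless.irrefl b
    simp only [mem_union, mem_erase, mem_outerBoundary, mem_freshNeighbors, mem_insert]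
    grind
  have hdisj : Disjoint ((G.outerBoundary C).erase b) (G.freshNeighbors C b) := by
    rw [Finset.disjoint_left]
    intro w
    simp only [mem_erase, mem_outerBoundary, mem_freshNeighbors]
    grind
  have h := card_le_card hsub
  rw [card_union_of_disjoint hdisj, card_erase_of_mem hb] at h
  omega

/-- Fresh neighbourhoods only shrink, and the one vertex leaving the boundary, `b`, was not dead. -/
theorem deadBoundary_subset_insert (hb : (G.freshNeighbors C b).Nonempty) :
    G.deadBoundary C ⊆ G.deadBoundary (insert b C) := by
  intro v hv
  rw [mem_deadBoundary] at hv ⊢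
  have hne : v ≠ b := by
    rintro rfl
    simp [hv.2] at hb
  refine ⟨?_, subset_empty.1 (freshNeighbors_insert_subset.trans hv.2.subset)⟩
  have := hv.1
  simp only [mem_outerBoundary, mem_insert] at this ⊢
  grind

theorem Connected.induce_insert (hC : (G.induce (C : Set V)).Connected)
    (hb : b ∈ G.outerBoundary C) : (G.induce (insert b C : Finset V)).Connected := by
  obtain ⟨-, c, hc, hcb⟩ := mem_outerBoundary.1 hb
  have h := induce_union_connected hC.preconnected
    (induce_pair_connected_of_adj hcb).preconnected ⟨c, by simpa using hc, by simp⟩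
  have heq : ((insert b C : Finset V) : Set V) = (C : Set V) ∪ {c, b} := by
    ext x
    simp only [coe_insert, Set.mem_insert_iff, Set.mem_union, mem_coe, Set.mem_singleton_iff]
    grind
  rwa [heq]

theorem Connected.induce_union (hC : (G.induce (C : Set V)).Connected) {X : Finset V}
    (hX : X ⊆ G.outerBoundary C) : (G.induce (C ∪ X : Finset V)).Connected := by
  induction X using Finset.induction_on with
  | empty => rwa [union_empty]
  | insert a s _ ih =>
    by_cases has : a ∈ C ∪ s
    · have : C ∪ insert a s = C ∪ s := by
        rw [union_insert, insert_eq_of_mem has]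
      rw [this]
      exact ih ((subset_insert _ _).trans hX)
    · rw [union_insert]
      refine (ih ((subset_insert _ _).trans hX)).induce_insert ?_
      obtain ⟨-, c, hc, h⟩ := mem_outerBoundary.1 (hX (mem_insert_self a s))
      exact mem_outerBoundary.2 ⟨has, c, mem_union_left _ hc, h⟩

/-- A nonempty vertex set whose closed neighbourhood is not everything has a boundary vertex with a
fresh neighbour. -/
theorem Connected.exists_fresh (hG : G.Connected) (hC : C.Nonempty) {x : V}
    (hx : x ∉ C) (hx' : x ∉ G.outerBoundary C) :
    ∃ b ∈ G.outerBoundary C, (G.freshNeighbors C b).Nonempty := by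
  obtain ⟨c, hc⟩ := hC
  obtain ⟨p⟩ := hG.preconnected c x
  obtain ⟨d, -, hd1, hd2⟩ := p.exists_boundary_dart ((C : Set V) ∪ G.outerBoundary C)
    (by simp [hc]) (by simp [hx, hx'])
  have hadj := d.adj
  refine ⟨d.fst, ?_, d.snd, ?_⟩
  all_goals
    simp only [Set.mem_union, mem_coe, mem_outerBoundary, mem_freshNeighbors] at *
    grind

/-- The greedy expansion step. -/
theorem Connected.exists_expansion (hG : G.Connected) [DecidableRel G.Adj]
    (hdeg : ∀ v, G.degree v ≠ 2) (hC : (G.induce (C : Set V)).Connected) (hne : C.Nonempty)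
    (hcard : C.card ≤ 2 * (G.outerBoundary C).card + (G.deadBoundary C).card)
    {z : V} (hz : z ∉ C) (hz' : z ∉ G.outerBoundary C) :
    ∃ C' : Finset V, C.card < C'.card ∧ (G.induce (C' : Set V)).Connected ∧
      C'.card ≤ 2 * (G.outerBoundary C').card + (G.deadBoundary C').card := by
  -- Absorbing such a `b` costs 1 in |C| and gains at least 1 in |B|, hence 2 on the right.
  by_cases hbig : ∃ b ∈ G.outerBoundary C, 2 ≤ (G.freshNeighbors C b).card
  · obtain ⟨b, hb, h2⟩ := hbig
    have h1 := card_outerBoundary_insert hb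
    have h3 := card_le_card (deadBoundary_subset_insert (card_pos.1 (pos_of_gt h2)))
    have h4 := card_insert_of_notMem (mem_outerBoundary.1 hb).1
    exact ⟨insert b C, by omega, hC.induce_insert hb, by omega⟩
  push Not at hbig
  obtain ⟨b, hb, hfresh⟩ := hG.exists_fresh hne hz hz'
  have hone : ∀ b' ∈ G.outerBoundary C, ∀ x ∈ G.freshNeighbors C b',
      ∀ y ∈ G.freshNeighbors C b', x = y := fun b' hb' =>
    fun x hx y hy => card_le_one.1 (Nat.lt_succ_iff.1 (hbig b' hb')) x hx y hy
  have hbC := card_insert_of_notMem (mem_outerBoundary.1 hb).1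
  have hB1 := card_outerBoundary_insert hb
  have hfpos := hfresh.card_pos
  have hD1 := deadBoundary_subset_insert hfresh
  obtain ⟨x, hx⟩ := hfresh
  obtain ⟨hbx, hxC, hxN⟩ := mem_freshNeighbors.1 hx
  have hxb : x ≠ b := hbx.ne'
  have hxB : x ∈ G.outerBoundary (insert b C) :=
    mem_outerBoundary.2 ⟨by simp [hxb, hxC], b, mem_insert_self _ _, hbx⟩
  -- Absorb both `b` and `x`: the cost 2 is paid by a net gain of at least 1 in |B|. The fresh
  -- neighbours of `x` stay fresh because `x` is the only one of `b`.
  by_cases hk : 2 ≤ (G.freshNeighbors C x).card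
  · have hsub : G.freshNeighbors C x ⊆ G.freshNeighbors (insert b C) x := by
      intro w hw
      obtain ⟨hxw, hwC, hwN⟩ := mem_freshNeighbors.1 hw
      refine mem_freshNeighbors.2 ⟨hxw, ?_, ?_⟩
      · simp only [mem_insert, not_or]
        refine ⟨?_, hwC⟩
        rintro rfl
        obtain ⟨-, c, hc, h⟩ := mem_outerBoundary.1 hb
        exact hwN c hc h
      · intro c hc hcw
        rcases mem_insert.1 hc with rfl | hc
        · exact hxw.ne (hone c hb x hx w (mem_freshNeighbors.2 ⟨hcw, hwC, hwN⟩))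
        · exact hwN c hc hcw
    have h1 := card_outerBoundary_insert hxB
    have h2 := card_le_card hsub
    have h3 := card_le_card hD1
    have h4 := card_le_card (deadBoundary_subset_insert (card_pos.1 (by omega :
      0 < (G.freshNeighbors (insert b C) x).card)))
    have h5 := card_insert_of_notMem (mem_outerBoundary.1 hxB).1
    exact ⟨insert x (insert b C), by omega, (hC.induce_insert hb).induce_insert hxB, by omega⟩
  -- Otherwise absorb `b` alone: |B| does not drop, and one newly dead vertex pays for it. It is
  -- either another boundary neighbour of `x`, whose only fresh neighbour was `x`, or `x` itself.
  have hdead : ∃ d ∈ G.deadBoundary (insert b C), d ∉ G.deadBoundary C := by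
    by_cases hb2 : ∃ b₂ ∈ G.outerBoundary C, b₂ ≠ b ∧ G.Adj b₂ x
    · obtain ⟨b₂, hb₂, hne₂, hadj⟩ := hb2
      have hx₂ : x ∈ G.freshNeighbors C b₂ := mem_freshNeighbors.2 ⟨hadj, hxC, hxN⟩
      refine ⟨b₂, mem_deadBoundary.2 ⟨?_, ?_⟩, fun h => ?_⟩
      · obtain ⟨h, c, hc, hcb⟩ := mem_outerBoundary.1 hb₂
        exact mem_outerBoundary.2 ⟨by simp [h, hne₂], c, mem_insert_of_mem hc, hcb⟩
      · refine eq_empty_of_forall_notMem fun w hw => ?_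
        have hwx := hone b₂ hb₂ w (freshNeighbors_insert_subset hw) x hx₂
        subst hwx
        exact (mem_freshNeighbors.1 hw).2.2 b (mem_insert_self _ _) hbx
      · rw [(mem_deadBoundary.1 h).2] at hx₂
        simp at hx₂
    · push Not at hb2
      have hsub : G.neighborFinset x ⊆ insert b (G.freshNeighbors C x) := by
        intro w hw
        rw [mem_neighborFinset] at hw
        by_cases hwb : w = b
        · simp [hwb]
        refine mem_insert_of_mem (mem_freshNeighbors.2 ⟨hw, fun h => hxN w h hw.symm, ?_⟩)
        intro c hc hcw
        refine hb2 w (mem_outerBoundary.2 ⟨fun h => hxN w h hw.symm, c, hc, hcw⟩) hwb hw.symm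
      have hbf : b ∉ G.freshNeighbors C x := by
        intro h
        obtain ⟨-, c, hc, hcb⟩ := mem_outerBoundary.1 hb
        exact (mem_freshNeighbors.1 h).2.2 c hc hcb
      -- The neighbours of `x` are `b` and at most one fresh vertex; degree 2 being excluded, `x` is
      -- a leaf.
      have hfx : G.freshNeighbors C x = ∅ := by
        by_contra hcon
        have hpos := card_pos.2 (nonempty_iff_ne_empty.2 hcon)
        apply hdeg x
        have hsup : insert b (G.freshNeighbors C x) ⊆ G.neighborFinset x := by
          intro w hw
          rw [mem_neighborFinset]
          rcases mem_insert.1 hw with rfl | hw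
          · exact hbx.symm
          · exact (mem_freshNeighbors.1 hw).1
        rw [← card_neighborFinset_eq_degree, hsub.antisymm hsup, card_insert_of_notMem hbf]
        omega
      refine ⟨x, mem_deadBoundary.2 ⟨hxB, ?_⟩, fun h => ?_⟩
      · exact subset_empty.1 (freshNeighbors_insert_subset.trans hfx.subset)
      · obtain ⟨-, c, hc, hcx⟩ := mem_outerBoundary.1 (mem_deadBoundary.1 h).1
        exact hxN c hc hcx
  obtain ⟨d, hd, hd'⟩ := hdead
  have h1 := card_lt_card ((ssubset_iff_of_subset hD1).2 ⟨d, hd, hd'⟩)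
  exact ⟨insert b C, by omega, hC.induce_insert hb, by omega⟩

/-- A connected graph without vertices of degree two has a connected dominating set containing at
most three quarters of the vertices. -/
theorem Connected.exists_connected_dominating [Nontrivial V] (hG : G.Connected)
    [DecidableRel G.Adj] (hdeg : ∀ v, G.degree v ≠ 2) :
    ∃ C : Finset V, C.Nonempty ∧ (G.induce (C : Set V)).Connected ∧
      Fintype.card V ≤ 4 * (G.outerBoundary C).card := by
  classical
  let P : Finset (Finset V) := univ.filter fun C => C.Nonempty ∧ (G.induce (C : Set V)).Connected ∧
      C.card ≤ 2 * (G.outerBoundary C).card + (G.deadBoundary C).card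
  have hP : P.Nonempty := by
    obtain ⟨v⟩ := hG.nonempty
    obtain ⟨w, hw⟩ := hG.preconnected.exists_adj_of_nontrivial v
    refine ⟨{v}, mem_filter.2 ⟨mem_univ _, singleton_nonempty _, ?_, ?_⟩⟩
    · rw [coe_singleton]
      exact (Subsingleton.elim ⊤ (G.induce {v})) ▸ connected_top
    · have : 0 < (G.outerBoundary {v}).card :=
        card_pos.2 ⟨w, mem_outerBoundary.2 ⟨by simpa using hw.ne', v, by simp, hw⟩⟩
      simp only [card_singleton]
      omega
  obtain ⟨C, hCP, hmax⟩ := P.exists_max_image card hP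
  obtain ⟨-, hne, hC, hcard⟩ := mem_filter.1 hCP
  refine ⟨C, hne, hC, ?_⟩
  have hcover : (univ : Finset V) ⊆ C ∪ G.outerBoundary C := by
    intro z _
    by_contra hz
    rw [mem_union, not_or] at hz
    obtain ⟨C', hlt, hC', hcard'⟩ := hG.exists_expansion hdeg hC hne hcard hz.1 hz.2
    have := hmax C' (mem_filter.2 ⟨mem_univ _, card_pos.1 (by omega), hC', hcard'⟩)
    omega
  have h1 := (card_le_card hcover).trans (card_union_le _ _)
  -- Each dead vertex lies in B, so |C| ≤ 3|B|.
  have h2 : (G.deadBoundary C).card ≤ (G.outerBoundary C).card := card_filter_le _ _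
  rw [card_univ] at h1
  omega

/-! ### Counting connected sets -/

theorem two_pow_lt_numConnectedSets (hne : C.Nonempty) (hC : (G.induce (C : Set V)).Connected)
    (hB : (G.outerBoundary C).Nonempty) :
    2 ^ (G.outerBoundary C).card < G.numConnectedSets := by
  have hdisj : ∀ X ⊆ G.outerBoundary C, Disjoint X C := fun X hX =>
    Finset.disjoint_left.2 fun v hv => (mem_outerBoundary.1 (hX hv)).1
  have hinj : Set.InjOn (fun X => C ∪ X) ((G.outerBoundary C).powerset : Set (Finset V)) := by
    intro X hX Y hY hXY
    have hX := hdisj X (by simpa using hX)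
    have hY := hdisj Y (by simpa using hY)
    rw [← union_sdiff_cancel_left hX.symm, ← union_sdiff_cancel_left hY.symm]
    exact congrArg (· \ C) hXY
  rw [← card_powerset, ← card_image_of_injOn hinj]
  refine card_lt_card ((ssubset_iff_of_subset ?_).2 ?_)
  · intro S hS
    obtain ⟨X, hX, rfl⟩ := mem_image.1 hS
    exact mem_connectedSets.2 ⟨hne.mono subset_union_left, hC.induce_union (mem_powerset.1 hX)⟩
  -- Strictness, needed because the entropy bound is not strict: `{b}` is connected but does not
  -- contain `C`.
  · obtain ⟨b, hb⟩ := hB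
    refine ⟨{b}, mem_connectedSets.2 ⟨singleton_nonempty b, ?_⟩, fun h => ?_⟩
    · rw [coe_singleton]
      exact (Subsingleton.elim ⊤ (G.induce {b})) ▸ connected_top
    · obtain ⟨X, -, hX⟩ := mem_image.1 h
      obtain ⟨c, hc⟩ := hne
      have hcb : c ∈ ({b} : Finset V) := hX ▸ mem_union_left X hc
      rw [mem_singleton] at hcb
      exact (mem_outerBoundary.1 hb).1 (hcb ▸ hc)

end SimpleGraph

/-! ### The entropy root and its numerical value -/

theorem IsEntropyRoot.binEntropy_eq {c a : ℝ} (h : IsEntropyRoot c a) :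
    Real.binEntropy a = Real.log (2 * c) := by
  obtain ⟨⟨h1, h2⟩, h3⟩ := h
  rw [← h3, Real.rpow_def_of_pos (by linarith), Real.rpow_def_of_pos (by linarith),
    ← Real.exp_add, Real.log_exp, Real.binEntropy, Real.log_inv, Real.log_inv]
  ring

theorem isEntropyRoot_two_rpow :
    IsEntropyRoot ((2 : ℝ) ^ (-(3 / 4) : ℝ)) (entropyRoot ((2 : ℝ) ^ (-(3 / 4) : ℝ))) := by
  apply entropyRoot_spec
  · rw [one_div, ← Real.rpow_neg_one]
    exact Real.rpow_lt_rpow_of_exponent_lt (by norm_num) (by norm_num)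
  · exact Real.rpow_lt_one_of_one_lt_of_neg (by norm_num) (by norm_num)

theorem binEntropy_entropyRoot_two_rpow :
    Real.binEntropy (entropyRoot ((2 : ℝ) ^ (-(3 / 4) : ℝ))) = Real.log 2 / 4 := by
  rw [isEntropyRoot_two_rpow.binEntropy_eq, Real.log_mul (by norm_num) (by positivity),
    Real.log_rpow (by norm_num)]
  ring

set_option exponentiation.threshold 500 in
theorem binEntropy_lt_log_two_div_four : Real.binEntropy 0.95831 < Real.log 2 / 4 := by
  have key : ∀ (x : ℝ) (k m : ℕ), 0 < x → x ^ k ≤ 2 ^ m →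
      k * Real.log x ≤ m * Real.log 2 := by
    intro x k m hx h
    rw [← Real.log_pow, ← Real.log_pow]
    exact Real.log_le_log (by positivity) h
  -- 29/472 and 408/89 are tight rational upper bounds for -log₂ 0.95831 and -log₂ 0.04169; their
  -- weighted sum is just below 1/4.
  have h1 := key (0.95831)⁻¹ 472 29 (by norm_num) (by norm_num)
  have h2 := key (1 - 0.95831)⁻¹ 89 408 (by norm_num) (by norm_num)
  have h3 := Real.log_pos (one_lt_two)
  rw [Real.binEntropy]
  push_cast at h1 h2
  linarith

theorem entropyRoot_two_rpow_lt : entropyRoot ((2 : ℝ) ^ (-(3 / 4) : ℝ)) < 0.95831 := by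
  obtain ⟨⟨h1, h2⟩, -⟩ := isEntropyRoot_two_rpow
  refine (Real.binEntropy_strictAntiOn.lt_iff_gt ?_ ?_).1
    (binEntropy_lt_log_two_div_four.trans_eq binEntropy_entropyRoot_two_rpow.symm)
  · norm_num
  · exact ⟨by linarith, h2.le⟩

/-! ### Conclusion -/

theorem SimpleGraph.Connected.connectedSetDensity_lt {V : Type*} [Fintype V] [Nontrivial V]
    {G : SimpleGraph V} [DecidableRel G.Adj] (hG : G.Connected) (hdeg : ∀ v, G.degree v ≠ 2) :
    G.connectedSetDensity < entropyRoot ((2 : ℝ) ^ (-(3 / 4) : ℝ)) := by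
  classical
  obtain ⟨C, hne, hC, hcard⟩ := hG.exists_connected_dominating hdeg
  have hn : 0 < Fintype.card V := Fintype.card_pos
  have hN := two_pow_lt_numConnectedSets hne hC (Finset.card_pos.1 (by omega))
  have hN0 : (0 : ℝ) < G.numConnectedSets := by exact_mod_cast pos_of_gt hN
  have hn0 : (0 : ℝ) < Fintype.card V := by exact_mod_cast hn
  by_contra! hD
  set a := entropyRoot ((2 : ℝ) ^ (-(3 / 4) : ℝ)) with ha
  obtain ⟨⟨h1, h2⟩, -⟩ := isEntropyRoot_two_rpow
  rw [connectedSetDensity, le_div_iff₀ hn0, avgConnectedSetOrder, inv_mul_eq_div,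
    le_div_iff₀ hN0] at hD
  have h3 := card_le_exp_binEntropy h1.le h2 G.connectedSets hD
  rw [binEntropy_entropyRoot_two_rpow] at h3
  have h4 : (2 : ℝ) ^ (G.outerBoundary C).card < G.numConnectedSets := by exact_mod_cast hN
  have h5 : Real.exp ((Fintype.card V : ℝ) * (Real.log 2 / 4)) ≤
      (2 : ℝ) ^ (G.outerBoundary C).card := by
    rw [← Real.exp_log (show (0 : ℝ) < 2 ^ (G.outerBoundary C).card by positivity), Real.log_pow]
    apply Real.exp_le_exp.2
    have h6 : (Fintype.card V : ℝ) ≤ 4 * (G.outerBoundary C).card := by exact_mod_cast hcard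
    have := mul_le_mul_of_nonneg_right h6 (Real.log_pos one_lt_two).le
    linarith
  exact absurd (h4.trans_le (h3.trans h5)) (lt_irrefl _)

theorem mainTheorem1 :
    (∀ (V : Type*) [Fintype V] [Nontrivial V] (G : SimpleGraph V) [DecidableRel G.Adj],
      G.Connected → (∀ v : V, G.degree v ≠ 2) →
        G.connectedSetDensity < entropyRoot ((2 : ℝ) ^ (-(3 / 4) : ℝ))) ∧
    entropyRoot ((2 : ℝ) ^ (-(3 / 4) : ℝ)) < 0.95831 ∧
    (∃ ε : ℝ, 0 < ε ∧
      ∀ (V : Type*) [Fintype V] (G : SimpleGraph V) [DecidableRel G.Adj],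
        G.Connected → (∀ v : V, 3 ≤ G.degree v) → G.connectedSetDensity ≤ 1 - ε) := by
  refine ⟨fun V _ _ G _ hG hdeg => hG.connectedSetDensity_lt hdeg, entropyRoot_two_rpow_lt,
    1 - entropyRoot ((2 : ℝ) ^ (-(3 / 4) : ℝ)), sub_pos.2 isEntropyRoot_two_rpow.1.2, ?_⟩
  intro V _ G _ hG hdeg
  obtain ⟨v⟩ := hG.nonempty
  obtain ⟨w, hw⟩ := (G.degree_pos_iff_exists_adj v).1 (by have := hdeg v; omega)
  have : Nontrivial V := ⟨v, w, hw.ne⟩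
  rw [sub_sub_cancel]
  exact (hG.connectedSetDensity_lt fun v h => by have := hdeg v; omega).le
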